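/- Let $d\ge 2$, let $\nu_d$ be Lebesgue measure on $\mathbb{R}^d$ and $\kappa_d=\nu_d(\bar B(0,1))$ the volume of the closed unit ball. Let $\mathbb{F}$ be a measure on $(0,\infty)$ that is finite on bounded Borel subsets of $(0,\infty)$, put $F(z)=\mathbb{F}((0,z])$ for $z\ge 0$, and write $\int_a^b g(t)\,dF(t)=\int_{(a,b]} g\,d\mathbb{F}$. Let $\eta$ be a Poisson process on $\mathbb{R}^d\times(0,\infty)$ with intensity measure $\nu_d\times\mathbb{F}$, identified with its set of points (it is almost surely simple). For $(x,h)\in\eta$ let $$C((x,h),\eta)=\{v\in\mathbb{R}^d:\ \|v-x\|^2+h\le\|v-x'\|^2+h'\ \text{ for all }(x',h')\in\eta\}$$ be its Laguerre cell. For $y\in\mathbb{R}^d$ define the thinning $$\eta^y=\{(x,h)\in\eta:\ x+y\in C((x,h),\eta)\}.$$ Then $\eta^y$ is a point process on $\mathbb{R}^d\times(0,\infty)$, and its intensity measure $\Lambda^y=\mathbb{E}[\eta^y(\cdot)]$ satisfies, for every Borel set $B\subset\mathbb{R}^d$ and every $z\ge 0$, $$\Lambda^y(B\times(0,z])=\nu_d(B)\int_0^z\exp\left(-\kappa_d\int_0^{\|y\|^2+h}\left(\|y\|^2+h-t\right)^{d/2}\,dF(t)\right)dF(h)$$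 (with values in $[0,\infty]$ and the convention $\infty\cdot 0=0$). -/

import Mathlib

open MeasureTheory ProbabilityTheory
open scoped ENNReal

noncomputable section

namespace PoissonLaguerre

/-- The space `ℝ^d × (0, ∞)` of weighted points `(x, h)`. -/
abbrev WPoint (d : ℕ) : Type := EuclideanSpace ℝ (Fin d) × Set.Ioi (0 : ℝ)

/-- Local finiteness in the sense of point process theory: every bounded Borel set has
finite measure. -/
def IsBoundedlyFinite {X : Type*} [MeasurableSpace X] [Bornology X] (μ : Measure X) : Prop :=
  ∀ B : Set X, MeasurableSet B → Bornology.IsBounded B → μ B < ∞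

/-- The measure takes values in `{0, 1, 2, …} ∪ {∞}`. -/
def IsIntegerValued {X : Type*} [MeasurableSpace X] (μ : Measure X) : Prop :=
  ∀ B : Set X, MeasurableSet B → ∃ n : ℕ∞, μ B = (n : ℝ≥0∞)

/-- The space `N(X)` of locally finite counting measures on `X`. -/
def CountingMeasure (X : Type*) [MeasurableSpace X] [Bornology X] : Type _ :=
  {μ : Measure X // IsBoundedlyFinite μ ∧ IsIntegerValued μ}

/-- The σ-algebra on `N(X)` induced from that of `Measure X`, that is, the smallest one for which
all evaluations `μ ↦ μ B`, with `B` measurable, are measurable. -/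
instance (X : Type*) [MeasurableSpace X] [Bornology X] : MeasurableSpace (CountingMeasure X) :=
  inferInstanceAs (MeasurableSpace {μ : Measure X // IsBoundedlyFinite μ ∧ IsIntegerValued μ})

/-- The underlying measure of a counting measure. -/
def CountingMeasure.toMeasure {X : Type*} [MeasurableSpace X] [Bornology X]
    (μ : CountingMeasure X) : Measure X := μ.1

lemma CountingMeasure.measurable_toMeasure {X : Type*} [MeasurableSpace X] [Bornology X] :
    Measurable (CountingMeasure.toMeasure : CountingMeasure X → Measure X) :=
  measurable_subtype_coe

/-- The Poisson distribution with mean `r ∈ [0, ∞]`, as a law on `[0, ∞]`. With mean `∞` it is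
the point mass at `∞`. -/
def poissonLaw (r : ℝ≥0∞) : Measure ℝ≥0∞ :=
  if r = ∞ then Measure.dirac ∞ else (poissonMeasure r.toNNReal).map (fun n : ℕ => (n : ℝ≥0∞))

/-- `η` is a Poisson process on `X` with intensity measure `Λ` (a σ-finite measure). -/
structure IsPoissonProcess {Ω X : Type*} [MeasurableSpace Ω] [MeasurableSpace X] [Bornology X]
    (P : Measure Ω) (η : Ω → CountingMeasure X) (Λ : Measure X) : Prop where
  measurable : Measurable η
  map_eq_poissonLaw : ∀ B : Set X, MeasurableSet B →
    P.map (fun ω => (η ω).toMeasure B) = poissonLaw (Λ B)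
  iIndepFun : ∀ (m : ℕ) (B : Fin m → Set X), (∀ i, MeasurableSet (B i)) →
    Pairwise (fun i j => Disjoint (B i) (B j)) →
    ProbabilityTheory.iIndepFun (fun (i : Fin m) ω => (η ω).toMeasure (B i)) P

/-- The intensity measure `Λ(B) = E[ξ(B)]` of a point process `ξ`. -/
def intensityMeasure {Ω X : Type*} [MeasurableSpace Ω] [MeasurableSpace X] [Bornology X]
    (P : Measure Ω) (ξ : Ω → CountingMeasure X) : Measure X :=
  P.bind (fun ω => (ξ ω).toMeasure)

lemma intensityMeasure_apply {Ω X : Type*} [MeasurableSpace Ω] [MeasurableSpace X] [Bornology X]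
    {P : Measure Ω} {ξ : Ω → CountingMeasure X} (hξ : Measurable ξ) {B : Set X}
    (hB : MeasurableSet B) :
    intensityMeasure P ξ B = ∫⁻ ω, (ξ ω).toMeasure B ∂P :=
  Measure.bind_apply hB (CountingMeasure.measurable_toMeasure.comp hξ).aemeasurable

/-- The set of points of a counting measure. -/
def CountingMeasure.points {X : Type*} [MeasurableSpace X] [Bornology X]
    (μ : CountingMeasure X) : Set X := {p | μ.toMeasure {p} ≠ 0}

/-- The simple counting measure `∑ δ_p`, `p ∈ S`, of a set `S` of points of `μ`. -/
def CountingMeasure.ofSubset {X : Type*} [MeasurableSpace X] [MeasurableSingletonClass X]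
    [Bornology X] (μ : CountingMeasure X) (S : Set X) (hS : S ⊆ μ.points) : CountingMeasure X :=
  ⟨Measure.sum (fun p : S => Measure.dirac (p : X)), by
    have key : ∀ B : Set X, MeasurableSet B →
        Measure.sum (fun p : S => Measure.dirac (p : X)) B
          = ∑' p : S, B.indicator (1 : X → ℝ≥0∞) (p : X) := by
      intro B hB
      rw [Measure.sum_apply _ hB]
      exact tsum_congr fun p => Measure.dirac_apply' _ hB
    refine ⟨fun B hB hbd => ?_, fun B hB => ?_⟩
    · refine lt_of_le_of_lt ?_ (μ.2.1 B hB hbd)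
      rw [key B hB, ENNReal.tsum_eq_iSup_sum]
      refine iSup_le fun T => ?_
      calc ∑ p ∈ T, B.indicator (1 : X → ℝ≥0∞) (p : X)
          ≤ ∑ p ∈ T, μ.1 (B ∩ {(p : X)}) := by
            refine Finset.sum_le_sum fun p _ => ?_
            by_cases hp : (p : X) ∈ B
            · rw [Set.indicator_of_mem hp, Set.inter_eq_self_of_subset_right (by simpa using hp)]
              obtain ⟨n, hn⟩ := μ.2.2 {(p : X)} (measurableSet_singleton _)
              have h0 : μ.1 {(p : X)} ≠ 0 := hS p.2
              rw [hn] at h0 ⊢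
              have : n ≠ 0 := by rintro rfl; simp at h0
              have h1 : (1 : ℕ∞) ≤ n := Order.one_le_iff_ne_zero.mpr this
              have h2 := ENat.toENNReal_le.mpr h1
              simpa using h2
            · simp [Set.indicator_of_notMem hp]
        _ = μ.1 (⋃ p ∈ T, B ∩ {(p : X)}) := by
            refine (measure_biUnion_finset ?_ fun p _ => hB.inter (measurableSet_singleton _)).symm
            intro p _ q _ hpq
            refine Set.disjoint_left.mpr ?_
            rintro x ⟨_, hx⟩ ⟨_, hx'⟩
            exact hpq (Subtype.ext ((Set.mem_singleton_iff.mp hx).symm.trans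
              (Set.mem_singleton_iff.mp hx')))
        _ ≤ μ.1 B := measure_mono (Set.iUnion₂_subset fun p _ => Set.inter_subset_left)
    · refine ⟨Set.encard {p : S | (p : X) ∈ B}, ?_⟩
      rw [key B hB, ← ENNReal.tsum_set_one, tsum_subtype {p : S | (p : X) ∈ B} (fun _ => 1)]
      rfl⟩

/-- The Laguerre cell `C((x, h), φ)` of a weighted point in a set `φ` of weighted points. -/
def laguerreCell {d : ℕ} (p : WPoint d) (φ : Set (WPoint d)) : Set (EuclideanSpace ℝ (Fin d)) :=
  {v | ∀ q ∈ φ, ‖v - p.1‖ ^ 2 + (p.2 : ℝ) ≤ ‖v - q.1‖ ^ 2 + (q.2 : ℝ)}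

/-- The thinning: the points `(x, h)` of `μ` with `x + y ∈ C((x, h), μ)`, as a set. -/
def thinningPoints {d : ℕ} (y : EuclideanSpace ℝ (Fin d)) (μ : CountingMeasure (WPoint d)) :
    Set (WPoint d) :=
  {p ∈ μ.points | p.1 + y ∈ laguerreCell p μ.points}

/-- The thinning as a (simple) counting measure. -/
def thinning {d : ℕ} (y : EuclideanSpace ℝ (Fin d)) (μ : CountingMeasure (WPoint d)) :
    CountingMeasure (WPoint d) :=
  μ.ofSubset (thinningPoints y μ) fun _ hp => hp.1

/-- `κ_d`, the volume of the closed unit ball of `ℝ^d`. -/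
def kappa (d : ℕ) : ℝ :=
  (volume (Metric.closedBall (0 : EuclideanSpace ℝ (Fin d)) 1)).toReal

end PoissonLaguerre

end

/-!
A point `p = (x, h)` of `η` survives the thinning exactly when `η` has no point in the open set
`A p = {(x', h') | ‖x + y - x'‖ ^ 2 + h' < ‖y‖ ^ 2 + h}`, which does not contain `p`. Integrating
over `h'` the volume of a ball of radius `(‖y‖ ^ 2 + h - h') ^ (1 / 2)` shows that `A p` has
intensity `κ_d ∫ (‖y‖ ^ 2 + h - t) ^ (d / 2) dF(t)` (`measure_blocking`), so it is void with
probability the exponential of minus this number. The theorem is therefore an instance of the Mecke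
formula: the expected number of `p ∈ η ∩ S` with `η (A p) = 0` is the integral over `S` of
`P (η (A p) = 0)` against the intensity measure `Λ`.

Only the following special case of the Mecke formula is needed
(`IsPoissonProcess.lintegral_voidInd_open`). The relation `q ∈ A p` is open, hence a countable union
of products `U i ×ˢ V i`, and `U i` is disjoint from `V i` because `p ∉ A p`. The sets
`A_n p = ⋃ {V i | i < n, p ∈ U i}` increase to `A p` and depend only on which of the first `n` sets
`U i` contain `p`. On each of the finitely many cells `C` so obtained, `A_n` is a fixed set
disjoint from `C`, so that independence gives `E[η(C ∩ S); η(A_n) = 0] = Λ(C ∩ S) P(η(A_n) = 0)`.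
Summing over the cells and letting `n → ∞` monotonically proves the formula, with points counted by
multiplicity.

The thinning counts every point once, so it must also be known that `η` is almost surely simple
(`IsPoissonProcess.ae_simple`). This follows from the same formula, applied to `A p = S \ {p}` with
`S` open of finite intensity: as `Λ` is diffuse, the expected number of points alone in `S` is
`Λ(S) exp(-Λ(S))`, which is also the probability that `η(S) = 1`. Hence almost surely no multiple
point is alone in a member of a countable base of the topology, whereas local finiteness isolates
every point of `η`.

The thinning is measurable because its value at `B` is the integral over `B` against `μ` of
`1{μ(A p) = 0} / μ{p}` (`CountingMeasure.ofSubset_apply`), where the integrand is jointly measurable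
in `p` and `μ`, and the identity is an s-finite kernel from counting measures to points.
-/

namespace PoissonLaguerre

/-! ### Counting measures -/

section Counting

variable {X : Type*} [MeasurableSpace X] [PseudoMetricSpace X]

lemma CountingMeasure.one_le_of_ne_zero (μ : CountingMeasure X) {B : Set X}
    (hB : MeasurableSet B) (h : μ.toMeasure B ≠ 0) : 1 ≤ μ.toMeasure B := by
  obtain ⟨n, hn⟩ := μ.2.2 B hB
  change μ.toMeasure B = n at hn
  rw [hn] at h ⊢
  have : n ≠ 0 := by rintro rfl; simp at h
  simpa using ENat.toENNReal_le.mpr (Order.one_le_iff_ne_zero.mpr this)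

instance (μ : CountingMeasure X) [OpensMeasurableSpace X] :
    IsLocallyFiniteMeasure μ.toMeasure :=
  ⟨fun x => ⟨Metric.ball x 1, Metric.ball_mem_nhds x one_pos,
    μ.2.1 _ measurableSet_ball Metric.isBounded_ball⟩⟩

lemma CountingMeasure.singleton_ne_top [OpensMeasurableSpace X] (μ : CountingMeasure X) (p : X) :
    μ.toMeasure {p} ≠ ∞ :=
  (isCompact_singleton.measure_lt_top).ne

/-- A counting measure vanishes near every point of a measurable set complementary to its atoms:
the measures of small neighbourhoods tend to the mass of the point and are integers. -/
lemma CountingMeasure.exists_isOpen_inter_null [BorelSpace X] [SecondCountableTopology X]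
    (μ : CountingMeasure X) {C : Set X} (hC : MeasurableSet C) {x : X}
    (hx : μ.toMeasure ({x} ∩ C) = 0) :
    ∃ U : Set X, IsOpen U ∧ x ∈ U ∧ μ.toMeasure (U ∩ C) = 0 := by
  have h1 : (μ.toMeasure.restrict C) {x} < 1 := by
    rw [Measure.restrict_apply' hC, hx]; exact one_pos
  obtain ⟨U, hxU, hU, hlt⟩ := Set.exists_isOpen_lt_of_lt _ _ h1
  refine ⟨U, hU, hxU rfl, ?_⟩
  rw [Measure.restrict_apply' hC] at hlt
  by_contra h
  exact absurd (μ.one_le_of_ne_zero (hU.measurableSet.inter hC) h) (not_le.mpr hlt)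

variable [BorelSpace X] [SecondCountableTopology X]

lemma CountingMeasure.countable_points [MeasurableSingletonClass X] (μ : CountingMeasure X) :
    μ.points.Countable := by
  have := Measure.countable_meas_pos_of_disjoint_iUnion (μ := μ.toMeasure)
    (As := fun x : X => {x}) (fun x => measurableSet_singleton x)
    (fun x y hxy => by simpa using hxy)
  simp only [pos_iff_ne_zero] at this
  exact this

/-- Locally finite counting measures on a separable metric space are purely atomic. -/
lemma CountingMeasure.measure_compl_points [MeasurableSingletonClass X] (μ : CountingMeasure X) :
    μ.toMeasure μ.pointsᶜ = 0 := by
  refine measure_null_of_locally_null _ fun x hx => ?_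
  have hx0 : μ.toMeasure {x} = 0 := by simpa [points] using hx
  obtain ⟨U, hU, hxU, h0⟩ := μ.exists_isOpen_inter_null
    μ.countable_points.measurableSet.compl (measure_mono_null Set.inter_subset_left hx0)
  exact ⟨_, inter_mem_nhdsWithin _ (hU.mem_nhds hxU), by rwa [Set.inter_comm]⟩

lemma CountingMeasure.ae_mem_points [MeasurableSingletonClass X] (μ : CountingMeasure X) :
    ∀ᵐ p ∂μ.toMeasure, p ∈ μ.points :=
  μ.measure_compl_points

lemma CountingMeasure.measure_eq_zero_iff [MeasurableSingletonClass X] (μ : CountingMeasure X)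
    (A : Set X) : μ.toMeasure A = 0 ↔ ∀ q ∈ μ.points, q ∉ A := by
  refine ⟨fun h q hq hqA => hq (measure_mono_null (Set.singleton_subset_iff.mpr hqA) h),
    fun h => measure_mono_null (fun q hqA hq => h q hq hqA) μ.measure_compl_points⟩

lemma CountingMeasure.setLIntegral_eq_tsum [MeasurableSingletonClass X] (μ : CountingMeasure X)
    {B : Set X} (hB : MeasurableSet B) (f : X → ℝ≥0∞) :
    ∫⁻ p in B, f p ∂μ.toMeasure = ∑' p : μ.points, B.indicator f p * μ.toMeasure {(p : X)} := by
  rw [← lintegral_indicator hB, ← lintegral_countable _ μ.countable_points,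
    Measure.restrict_eq_self_of_ae_mem μ.ae_mem_points]

end Counting

/-! ### Joint measurability of integrals against a counting measure -/

section Kernel

variable {X : Type*} [MeasurableSpace X] [PseudoMetricSpace X] [BorelSpace X]

/-- The identity `μ ↦ μ` as a kernel from `N(X)` to `X`. -/
noncomputable def countingKernel (X : Type*) [MeasurableSpace X] [PseudoMetricSpace X] :
    Kernel (CountingMeasure X) X where
  toFun := CountingMeasure.toMeasure
  measurable' := CountingMeasure.measurable_toMeasure

/-- The space is a countable union of bounded sets, and for bounded `S` the restriction to `S` is
the sum over `m` of the kernels `μ ↦ 1{μ(S) = m} μ|_S`, each of total mass at most `m`. -/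
instance : IsSFiniteKernel (countingKernel X) := by
  rcases isEmpty_or_nonempty X with hX | ⟨⟨x₀⟩⟩
  · have : countingKernel X = 0 := by
      ext μ B
      simp [Set.eq_empty_of_isEmpty B]
    rw [this]; infer_instance
  set S : ℕ → Set X := disjointed fun n : ℕ => Metric.ball x₀ n with hS
  have hSm : ∀ n, MeasurableSet (S n) :=
    MeasurableSet.disjointed fun n => measurableSet_ball
  have hSb : ∀ n, Bornology.IsBounded (S n) := fun n =>
    Metric.isBounded_ball.subset (disjointed_subset _ n)
  have hSd : Pairwise (Function.onFun Disjoint S) := disjoint_disjointed _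
  have hSU : ⋃ n, S n = Set.univ := by
    rw [hS, iUnion_disjointed, Metric.iUnion_ball_nat]
  have hT : ∀ n m : ℕ, MeasurableSet {μ : CountingMeasure X | μ.toMeasure (S n) = m} := fun n m =>
    ((Measure.measurable_coe (hSm n)).comp CountingMeasure.measurable_toMeasure)
      (measurableSet_singleton _)
  classical
  let κ : ℕ × ℕ → Kernel (CountingMeasure X) X := fun k =>
    Kernel.piecewise (hT k.1 k.2) (Kernel.restrict (countingKernel X) (hSm k.1)) 0
  have hκ : ∀ k, IsSFiniteKernel (κ k) := fun k => by
    have : IsFiniteKernel (κ k) := by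
      refine ⟨⟨k.2, by simp, fun μ => ?_⟩⟩
      simp only [κ, Kernel.piecewise_apply]
      split_ifs with h
      · rw [Kernel.restrict_apply, Measure.restrict_apply_univ]
        exact le_of_eq h
      · simp
    infer_instance
  have hsum : countingKernel X = Kernel.sum κ := by
    ext μ B hB
    rw [Kernel.sum_apply' _ _ hB, ENNReal.tsum_prod']
    have : ∀ n, ∑' m, κ (n, m) μ B = μ.toMeasure (B ∩ S n) := by
      intro n
      obtain ⟨N, hN⟩ := μ.2.2 (S n) (hSm n)
      have hfin : μ.toMeasure (S n) < ∞ := μ.2.1 _ (hSm n) (hSb n)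
      change μ.toMeasure (S n) = N at hN
      lift N to ℕ using (by rintro rfl; simp [hN] at hfin)
      rw [tsum_eq_single N]
      · simp only [κ, Kernel.piecewise_apply]
        rw [if_pos (by simpa using hN), Kernel.restrict_apply, Measure.restrict_apply hB]
        rfl
      · intro m hm
        simp only [κ, Kernel.piecewise_apply]
        rw [if_neg]
        · simp
        · intro h
          have h' : μ.toMeasure (S n) = m := h
          rw [hN] at h'
          exact hm (by simpa using h'.symm)
    simp_rw [this]
    rw [← measure_iUnion (fun i j hij => (hSd hij).mono Set.inter_subset_right
      Set.inter_subset_right) (fun n => hB.inter (hSm n)), ← Set.inter_iUnion, hSU, Set.inter_univ]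
    rfl
  rw [hsum]
  infer_instance

lemma measurable_toMeasure_section {A : Set (X × X)} (hA : MeasurableSet A) :
    Measurable fun z : CountingMeasure X × X => z.1.toMeasure (Prod.mk z.2 ⁻¹' A) :=
  Kernel.measurable_kernel_prodMk_left (κ := Kernel.prodMkRight X (countingKernel X))
    (t := {w : (CountingMeasure X × X) × X | (w.1.2, w.2) ∈ A})
    ((measurable_fst.snd.prodMk measurable_snd) hA)

lemma measurable_setLIntegral_toMeasure {f : CountingMeasure X × X → ℝ≥0∞} (hf : Measurable f)
    {B : Set X} (hB : MeasurableSet B) :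
    Measurable fun μ : CountingMeasure X => ∫⁻ p in B, f (μ, p) ∂μ.toMeasure :=
  Measurable.lintegral_kernel_prod_right' (κ := Kernel.restrict (countingKernel X) hB) hf

/-- The indicator function of `{0}` on `[0, ∞]`: `voidInd (μ A)` is `1` if `A` has no point of `μ`,
and `0` otherwise. -/
noncomputable def voidInd (r : ℝ≥0∞) : ℝ≥0∞ := Set.indicator {0} 1 r

lemma measurable_voidInd : Measurable voidInd :=
  measurable_one.indicator (measurableSet_singleton _)

lemma voidInd_antitone : Antitone voidInd := by
  intro a b hab
  by_cases hb : b = 0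
  · subst hb; simp [nonpos_iff_eq_zero.mp hab]
  · simp [voidInd, hb]

lemma voidInd_le_one (r : ℝ≥0∞) : voidInd r ≤ 1 := Set.indicator_le_self' (by simp) r

@[simp] lemma voidInd_zero : voidInd 0 = 1 := by simp [voidInd]

lemma voidInd_of_ne_zero {r : ℝ≥0∞} (h : r ≠ 0) : voidInd r = 0 := by simp [voidInd, h]

/-- The number of `p ∈ B` whose section of `A` has no point of `μ`, as an integral against `μ`:
dividing by the multiplicity `μ {p}` makes every point count once. -/
lemma CountingMeasure.ofSubset_apply [SecondCountableTopology X] [MeasurableSingletonClass X]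
    (μ : CountingMeasure X) {A : Set (X × X)} {S : Set X}
    (hS : S ⊆ μ.points) (hSA : ∀ p ∈ μ.points, p ∈ S ↔ μ.toMeasure (Prod.mk p ⁻¹' A) = 0)
    {B : Set X} (hB : MeasurableSet B) :
    (μ.ofSubset S hS).toMeasure B =
      ∫⁻ p in B, voidInd (μ.toMeasure (Prod.mk p ⁻¹' A)) * (μ.toMeasure {p})⁻¹ ∂μ.toMeasure := by
  have h1 : (μ.ofSubset S hS).toMeasure B = ∑' p : S, B.indicator (1 : X → ℝ≥0∞) (p : X) := by
    change Measure.sum (fun p : S => Measure.dirac (p : X)) B = _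
    rw [Measure.sum_apply _ hB]
    exact tsum_congr fun p => Measure.dirac_apply' _ hB
  rw [h1, μ.setLIntegral_eq_tsum hB, tsum_subtype S (B.indicator 1),
    tsum_subtype μ.points fun p => B.indicator _ p * μ.toMeasure {p}]
  refine tsum_congr fun p => ?_
  by_cases hp : p ∈ μ.points
  · have h2 : (μ.toMeasure {p})⁻¹ * μ.toMeasure {p} = 1 :=
      ENNReal.inv_mul_cancel hp (μ.singleton_ne_top p)
    by_cases hpB : p ∈ B
    · by_cases hpS : p ∈ S
      · simp [hp, hpB, hpS, (hSA p hp).mp hpS, h2]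
      · simp [hp, hpB, hpS, voidInd_of_ne_zero fun h => hpS ((hSA p hp).mpr h)]
    · by_cases hpS : p ∈ S <;> simp [hp, hpB, hpS]
  · have hpS : p ∉ S := fun h => hp (hS h)
    simp [hp, hpS]

end Kernel

/-! ### The Poisson law -/

section PoissonLaw

lemma poissonLaw_of_ne_top {r : ℝ≥0∞} (hr : r ≠ ∞) :
    poissonLaw r = (poissonMeasure r.toNNReal).map (fun n : ℕ => (n : ℝ≥0∞)) := if_neg hr

lemma poissonLaw_natCast {r : ℝ≥0∞} (hr : r ≠ ∞) (n : ℕ) :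
    poissonLaw r {(n : ℝ≥0∞)} =
      ENNReal.ofReal (Real.exp (-r.toReal) * r.toReal ^ n / n.factorial) := by
  rw [poissonLaw_of_ne_top hr, Measure.map_apply (by fun_prop) (measurableSet_singleton _)]
  have : (fun n : ℕ => (n : ℝ≥0∞)) ⁻¹' {(n : ℝ≥0∞)} = {n} := by ext; simp
  rw [this, poissonMeasure_singleton]
  rfl

lemma poissonLaw_zero {r : ℝ≥0∞} (hr : r ≠ ∞) :
    poissonLaw r {0} = ENNReal.ofReal (Real.exp (-r.toReal)) := by
  simpa using poissonLaw_natCast hr 0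

lemma poissonLaw_one {r : ℝ≥0∞} (hr : r ≠ ∞) :
    poissonLaw r {1} = ENNReal.ofReal (Real.exp (-r.toReal)) * r := by
  have h := poissonLaw_natCast hr 1
  rw [Nat.cast_one] at h
  rw [h, pow_one, Nat.factorial_one, Nat.cast_one, div_one, ENNReal.ofReal_mul (Real.exp_nonneg _),
    ENNReal.ofReal_toReal hr]

lemma lintegral_poissonLaw {r : ℝ≥0∞} (hr : r ≠ ∞) : ∫⁻ x, x ∂poissonLaw r = r := by
  rw [poissonLaw_of_ne_top hr, lintegral_map (f := fun x => x) measurable_id (by fun_prop),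
    lintegral_countable',
    tsum_eq_zero_add' ENNReal.summable]
  have h : ∀ n : ℕ, ((n + 1 : ℕ) : ℝ≥0∞) * poissonMeasure r.toNNReal {n + 1} =
      r * poissonMeasure r.toNNReal {n} := by
    intro n
    have hr' : r = ENNReal.ofReal (r.toNNReal : ℝ) := by simp [hr]
    generalize r.toNNReal = s at hr'
    subst hr'
    rw [poissonMeasure_singleton, poissonMeasure_singleton]
    rw [← ENNReal.ofReal_natCast, ← ENNReal.ofReal_mul (by positivity),
      ← ENNReal.ofReal_mul (by positivity)]
    congr 1
    rw [Nat.factorial_succ]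
    push_cast
    field_simp
    ring
  simp_rw [h]
  rw [ENNReal.tsum_mul_left]
  have h1 : ∑' n : ℕ, poissonMeasure r.toNNReal {n} = 1 := by
    have := lintegral_countable' (μ := poissonMeasure r.toNNReal) (fun _ => 1)
    simpa using this.symm
  simp [h1]

end PoissonLaw

/-! ### Poisson points whose associated region is void -/

section Void

lemma setLIntegral_comp_eq_tsum {Y ι : Type*} [MeasurableSpace Y] [MeasurableSpace ι] [Countable ι]
    [MeasurableSingletonClass ι] (μ : Measure Y) {c : Y → ι} (hc : Measurable c) (φ : ι → ℝ≥0∞)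
    (S : Set Y) :
    ∫⁻ p in S, φ (c p) ∂μ = ∑' j, φ j * μ (c ⁻¹' {j} ∩ S) := by
  rw [← lintegral_map (measurable_of_countable φ) hc, lintegral_countable']
  refine tsum_congr fun j => ?_
  rw [Measure.map_apply hc (measurableSet_singleton j),
    Measure.restrict_apply (hc (measurableSet_singleton j))]

lemma exists_seq_prod_of_isOpen {Y : Type*} [TopologicalSpace Y] [SecondCountableTopology Y]
    {A : Set (Y × Y)} (hA : IsOpen A) :
    ∃ U V : ℕ → Set Y, (∀ n, IsOpen (U n)) ∧ (∀ n, IsOpen (V n)) ∧ A = ⋃ n, U n ×ˢ V n := by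
  have hb := TopologicalSpace.isBasis_countableBasis Y
  set b := TopologicalSpace.countableBasis Y
  let T : Set (Set Y × Set Y) := insert (∅, ∅) {w | w ∈ b ×ˢ b ∧ w.1 ×ˢ w.2 ⊆ A}
  have hT : T.Countable := (((TopologicalSpace.countable_countableBasis Y).prod
    (TopologicalSpace.countable_countableBasis Y)).mono fun w hw => hw.1).insert _
  obtain ⟨f, hf⟩ := hT.exists_eq_range ⟨_, Set.mem_insert _ _⟩
  have hfT : ∀ n, f n ∈ T := fun n => hf ▸ Set.mem_range_self n
  refine ⟨fun n => (f n).1, fun n => (f n).2, fun n => ?_, fun n => ?_, ?_⟩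
  · rcases hfT n with h | h
    · simp [h]
    · exact hb.isOpen h.1.1
  · rcases hfT n with h | h
    · simp [h]
    · exact hb.isOpen h.1.2
  · apply Set.Subset.antisymm
    · rintro ⟨p, q⟩ hpq
      obtain ⟨U, V, hU, hV, hp, hq, hUV⟩ := isOpen_prod_iff.mp hA p q hpq
      obtain ⟨u, hu, hpu, huU⟩ := hb.exists_subset_of_mem_open hp hU
      obtain ⟨v, hv, hqv, hvV⟩ := hb.exists_subset_of_mem_open hq hV
      have : (u, v) ∈ T := Or.inr ⟨⟨hu, hv⟩, (Set.prod_mono huU hvV).trans hUV⟩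
      rw [hf] at this
      obtain ⟨n, hn⟩ := this
      exact Set.mem_iUnion.mpr ⟨n, by simpa only [hn] using ⟨hpu, hqv⟩⟩
    · refine Set.iUnion_subset fun n => ?_
      rcases hfT n with h | h
      · simp [h]
      · exact h.2

lemma voidInd_measure_iUnion {Y : Type*} [MeasurableSpace Y] (μ : Measure Y) {B : ℕ → Set Y} :
    voidInd (μ (⋃ n, B n)) = ⨅ n, voidInd (μ (B n)) := by
  by_cases h : μ (⋃ n, B n) = 0
  · have h0 := measure_iUnion_null_iff.mp h
    simp [h, h0]
  · obtain ⟨n, hn⟩ : ∃ n, μ (B n) ≠ 0 := by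
      by_contra! hn
      exact h (measure_iUnion_null_iff.mpr hn)
    rw [voidInd_of_ne_zero h]
    refine le_antisymm zero_le (iInf_le_of_le n ?_)
    rw [voidInd_of_ne_zero hn]

variable {X : Type*} [MeasurableSpace X] [PseudoMetricSpace X]
  {Ω : Type*} [MeasurableSpace Ω] {P : Measure Ω} {η : Ω → CountingMeasure X} {Λ : Measure X}

lemma IsPoissonProcess.measurable_apply (hη : IsPoissonProcess P η Λ) {B : Set X}
    (hB : MeasurableSet B) : Measurable fun ω => (η ω).toMeasure B :=
  (Measure.measurable_coe hB).comp (CountingMeasure.measurable_toMeasure.comp hη.measurable)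

lemma IsPoissonProcess.lintegral_apply (hη : IsPoissonProcess P η Λ) {B : Set X}
    (hB : MeasurableSet B) (h : Λ B ≠ ∞) : ∫⁻ ω, (η ω).toMeasure B ∂P = Λ B := by
  rw [← lintegral_poissonLaw h, ← hη.map_eq_poissonLaw B hB,
    lintegral_map (f := fun x => x) measurable_id (hη.measurable_apply hB)]

lemma IsPoissonProcess.measurable_voidInd (hη : IsPoissonProcess P η Λ) {B : Set X}
    (hB : MeasurableSet B) : Measurable fun ω => voidInd ((η ω).toMeasure B) :=
  PoissonLaguerre.measurable_voidInd.comp (hη.measurable_apply hB)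

lemma IsPoissonProcess.lintegral_voidInd (hη : IsPoissonProcess P η Λ) {B : Set X}
    (hB : MeasurableSet B) (h : Λ B ≠ ∞) :
    ∫⁻ ω, voidInd ((η ω).toMeasure B) ∂P = ENNReal.ofReal (Real.exp (-(Λ B).toReal)) := by
  rw [← poissonLaw_zero h, ← hη.map_eq_poissonLaw B hB,
    ← lintegral_map PoissonLaguerre.measurable_voidInd (hη.measurable_apply hB)]
  exact lintegral_indicator_one (measurableSet_singleton _)

lemma IsPoissonProcess.lintegral_voidInd_mul (hη : IsPoissonProcess P η Λ) {A B : Set X}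
    (hA : MeasurableSet A) (hB : MeasurableSet B) (hAB : Disjoint A B) (h : Λ B ≠ ∞) :
    ∫⁻ ω, voidInd ((η ω).toMeasure A) * (η ω).toMeasure B ∂P =
      (∫⁻ ω, voidInd ((η ω).toMeasure A) ∂P) * Λ B := by
  have hind := (hη.iIndepFun 2 ![A, B] (by simp [Fin.forall_fin_two, hA, hB]) (by
    intro i j hij
    fin_cases i <;> fin_cases j <;> simp_all [disjoint_comm])).indepFun
      (show (0 : Fin 2) ≠ 1 by decide)
  have hind' : IndepFun (fun ω => voidInd ((η ω).toMeasure A)) (fun ω => (η ω).toMeasure B) P :=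
    hind.comp PoissonLaguerre.measurable_voidInd measurable_id
  rw [← hη.lintegral_apply hB h]
  exact lintegral_mul_eq_lintegral_mul_lintegral_of_indepFun (hη.measurable_voidInd hA)
    (hη.measurable_apply hB) hind'

/-- The void formula when the region attached to `p` depends only on the cell `c p` of `p` in a
countable partition and avoids that cell. -/
lemma IsPoissonProcess.lintegral_voidInd_step (hη : IsPoissonProcess P η Λ)
    {ι : Type*} [MeasurableSpace ι] [Countable ι] [MeasurableSingletonClass ι]
    {c : X → ι} (hc : Measurable c) {W : ι → Set X} (hW : ∀ j, MeasurableSet (W j))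
    (hcW : ∀ p, p ∉ W (c p)) {S : Set X} (hS : MeasurableSet S) (hΛS : Λ S ≠ ∞) :
    ∫⁻ ω, ∫⁻ p in S, voidInd ((η ω).toMeasure (W (c p))) ∂(η ω).toMeasure ∂P =
      ∫⁻ p in S, ∫⁻ ω, voidInd ((η ω).toMeasure (W (c p))) ∂P ∂Λ := by
  have hcell : ∀ j, MeasurableSet (c ⁻¹' {j} ∩ S) := fun j =>
    (hc (measurableSet_singleton j)).inter hS
  have h1 : ∀ ω, ∫⁻ p in S, voidInd ((η ω).toMeasure (W (c p))) ∂(η ω).toMeasure =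
      ∑' j, voidInd ((η ω).toMeasure (W j)) * (η ω).toMeasure (c ⁻¹' {j} ∩ S) := fun ω =>
    setLIntegral_comp_eq_tsum _ hc (fun j => voidInd ((η ω).toMeasure (W j))) S
  rw [setLIntegral_comp_eq_tsum Λ hc (fun j => ∫⁻ ω, voidInd ((η ω).toMeasure (W j)) ∂P) S]
  simp_rw [h1]
  rw [lintegral_tsum (f := fun j ω =>
      voidInd ((η ω).toMeasure (W j)) * (η ω).toMeasure (c ⁻¹' {j} ∩ S)) fun j =>
    ((hη.measurable_voidInd (hW j)).mul (hη.measurable_apply (hcell j))).aemeasurable]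
  refine tsum_congr fun j => hη.lintegral_voidInd_mul (hW j) (hcell j) ?_
    (ne_top_of_le_ne_top hΛS (measure_mono Set.inter_subset_right))
  refine Set.disjoint_left.mpr fun q hq hq' => hcW q ?_
  rwa [show c q = j from hq'.1]

/-- The expected number of points `p` of `S`, counted with multiplicity, whose region `A p` is void
of points. An open relation off the diagonal is an increasing union of relations to which
the step case applies, and both sides pass to the limit. -/
theorem IsPoissonProcess.lintegral_voidInd_open [BorelSpace X] [SecondCountableTopology X]
    [IsProbabilityMeasure P] (hη : IsPoissonProcess P η Λ) {A : Set (X × X)} (hA : IsOpen A)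
    (hdiag : ∀ p, (p, p) ∉ A) {S : Set X} (hS : MeasurableSet S) (hΛS : Λ S ≠ ∞) :
    ∫⁻ ω, ∫⁻ p in S, voidInd ((η ω).toMeasure (Prod.mk p ⁻¹' A)) ∂(η ω).toMeasure ∂P =
      ∫⁻ p in S, ∫⁻ ω, voidInd ((η ω).toMeasure (Prod.mk p ⁻¹' A)) ∂P ∂Λ := by
  obtain ⟨U, V, hU, hV, rfl⟩ := exists_seq_prod_of_isOpen hA
  -- `c n p` records which of the first `n` sets `U i` contain `p`.
  let c : (n : ℕ) → X → (Fin n → Prop) := fun n p i => p ∈ U i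
  have hc : ∀ n, Measurable (c n) := fun n =>
    measurable_pi_lambda _ fun i => (hU i).measurableSet.mem
  let W : (n : ℕ) → (Fin n → Prop) → Set X := fun n j => ⋃ (i : Fin n) (_ : j i), V i
  have hW : ∀ n j, MeasurableSet (W n j) := fun n j =>
    MeasurableSet.iUnion fun i => MeasurableSet.iUnion fun _ => (hV i).measurableSet
  have hcW : ∀ n p, p ∉ W n (c n p) := by
    intro n p hp
    obtain ⟨i, hi, hpV⟩ := Set.mem_iUnion₂.mp hp
    exact hdiag p (Set.mem_iUnion.mpr ⟨i, hi, hpV⟩)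
  have hmono : ∀ p, Monotone fun n => W n (c n p) := by
    intro p m n hmn q hq
    obtain ⟨i, hi, hqV⟩ := Set.mem_iUnion₂.mp hq
    exact Set.mem_iUnion₂.mpr ⟨Fin.castLE hmn i, hi, hqV⟩
  have hsec : ∀ p, Prod.mk p ⁻¹' (⋃ n, U n ×ˢ V n) = ⋃ n, W n (c n p) := by
    intro p
    ext q
    simp only [Set.mem_preimage, Set.mem_iUnion, Set.mem_prod, W, c]
    constructor
    · rintro ⟨n, hp, hq⟩
      exact ⟨n + 1, ⟨n, n.lt_succ_self⟩, hp, hq⟩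
    · rintro ⟨n, i, hp, hq⟩
      exact ⟨i, hp, hq⟩
  have hanti : ∀ (μ : Measure X) p, Antitone fun n => voidInd (μ (W n (c n p))) :=
    fun μ p m n hmn => voidInd_antitone (measure_mono (hmono p hmn))
  have hfin : ∀ᵐ ω ∂P, (η ω).toMeasure S < ∞ :=
    ae_lt_top (hη.measurable_apply hS) (by rwa [hη.lintegral_apply hS hΛS])
  have hmeas : ∀ n (μ : Measure X), Measurable fun p => voidInd (μ (W n (c n p))) := fun n μ =>
    (measurable_of_countable fun j => voidInd (μ (W n j))).comp (hc n)
  have hbound : ∀ (μ : Measure X) n, ∫⁻ p in S, voidInd (μ (W n (c n p))) ∂μ ≤ μ S := fun μ n =>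
    (lintegral_mono fun p => voidInd_le_one _).trans (by simp)
  have hleft : ∀ᵐ ω ∂P,
      ∫⁻ p in S, voidInd ((η ω).toMeasure (Prod.mk p ⁻¹' (⋃ n, U n ×ˢ V n))) ∂(η ω).toMeasure =
        ⨅ n, ∫⁻ p in S, voidInd ((η ω).toMeasure (W n (c n p))) ∂(η ω).toMeasure := by
    filter_upwards [hfin] with ω hω
    simp_rw [hsec, voidInd_measure_iUnion]
    exact lintegral_iInf (fun n => hmeas n _) (fun m n hmn p => hanti _ p hmn)
      ((hbound _ 0).trans_lt hω).ne
  have hright : ∀ p, ∫⁻ ω, voidInd ((η ω).toMeasure (Prod.mk p ⁻¹' (⋃ n, U n ×ˢ V n))) ∂P =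
      ⨅ n, ∫⁻ ω, voidInd ((η ω).toMeasure (W n (c n p))) ∂P := by
    intro p
    simp_rw [hsec, voidInd_measure_iUnion]
    refine lintegral_iInf (fun n => hη.measurable_voidInd (hW n _))
      (fun m n hmn ω => hanti _ p hmn) (ne_top_of_le_ne_top (b := 1) (by simp) ?_)
    exact (lintegral_mono fun ω => voidInd_le_one _).trans (by simp)
  have hLmeas : ∀ n, Measurable fun ω =>
      ∫⁻ p in S, voidInd ((η ω).toMeasure (W n (c n p))) ∂(η ω).toMeasure := by
    intro n
    simp_rw [fun ω => setLIntegral_comp_eq_tsum (η ω).toMeasure (hc n)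
      (fun j => voidInd ((η ω).toMeasure (W n j))) S]
    exact Measurable.tsum fun j => (hη.measurable_voidInd (hW n j)).mul
      (hη.measurable_apply (((hc n) (measurableSet_singleton j)).inter hS))
  rw [lintegral_congr_ae hleft, lintegral_congr hright,
    lintegral_iInf hLmeas (fun m n hmn ω => lintegral_mono fun p => hanti _ p hmn),
    lintegral_iInf]
  · exact iInf_congr fun n => hη.lintegral_voidInd_step (hc n) (hW n) (hcW n) hS hΛS
  · exact fun n =>
      (measurable_of_countable fun j => ∫⁻ ω, voidInd ((η ω).toMeasure (W n j)) ∂P).comp (hc n)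
  · exact fun m n hmn p => lintegral_mono fun ω => hanti _ p hmn
  · refine ne_top_of_le_ne_top hΛS ((lintegral_mono (g := fun _ => 1) fun p => ?_).trans (by simp))
    exact (lintegral_mono fun ω => voidInd_le_one _).trans (by simp)
  · refine ne_top_of_le_ne_top hΛS ?_
    rw [← hη.lintegral_apply hS hΛS]
    exact lintegral_mono fun ω => hbound _ 0

end Void

/-! ### Simplicity of Poisson processes -/

section Simple

variable {X : Type*} [MeasurableSpace X] [MetricSpace X] [BorelSpace X]
  [SecondCountableTopology X]
  {Ω : Type*} [MeasurableSpace Ω] {P : Measure Ω} [IsProbabilityMeasure P]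
  {η : Ω → CountingMeasure X} {Λ : Measure X}

/-- The expected number of points of `S` that are alone in `S`, counted with multiplicity, equals
the probability of having exactly one point in `S`; so no point alone in `S` is multiple. -/
lemma IsPoissonProcess.ae_lintegral_voidInd_diff_singleton [NullSingletonClass Λ]
    (hη : IsPoissonProcess P η Λ) {S : Set X} (hS : IsOpen S) (hΛS : Λ S ≠ ∞) :
    ∀ᵐ ω ∂P, ∫⁻ p in S, voidInd ((η ω).toMeasure (S \ {p})) ∂(η ω).toMeasure ≤ 1 := by
  set A : Set (X × X) := {w | w.2 ∈ S ∧ w.2 ≠ w.1} with hAdef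
  have hA : IsOpen A :=
    (hS.preimage continuous_snd).inter (isOpen_ne_fun continuous_snd continuous_fst)
  have hsec : ∀ p, Prod.mk p ⁻¹' A = S \ {p} := fun p => rfl
  have key := hη.lintegral_voidInd_open hA (fun p hp => hp.2 rfl) hS.measurableSet hΛS
  simp_rw [hsec] at key
  have hvoid : ∀ p, ∫⁻ ω, voidInd ((η ω).toMeasure (S \ {p})) ∂P =
      ENNReal.ofReal (Real.exp (-(Λ S).toReal)) := by
    intro p
    have h : Λ (S \ {p}) = Λ S := measure_sdiff_null (measure_singleton p)
    rw [hη.lintegral_voidInd (hS.measurableSet.diff (measurableSet_singleton p)) (by rwa [h]), h]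
  simp_rw [hvoid] at key
  rw [setLIntegral_const] at key
  have hone : Measurable (Set.indicator {1} 1 : ℝ≥0∞ → ℝ≥0∞) :=
    measurable_one.indicator (measurableSet_singleton (1 : ℝ≥0∞))
  have hprob : ∫⁻ ω, Set.indicator {1} 1 ((η ω).toMeasure S) ∂P =
      ENNReal.ofReal (Real.exp (-(Λ S).toReal)) * Λ S := by
    rw [← poissonLaw_one hΛS, ← hη.map_eq_poissonLaw S hS.measurableSet,
      ← lintegral_map hone (hη.measurable_apply hS.measurableSet)]
    exact lintegral_indicator_one (measurableSet_singleton _)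
  have hmeas : Measurable fun ω =>
      ∫⁻ p in S, voidInd ((η ω).toMeasure (S \ {p})) ∂(η ω).toMeasure :=
    (measurable_setLIntegral_toMeasure (f := fun z => voidInd (z.1.toMeasure (Prod.mk z.2 ⁻¹' A)))
      (PoissonLaguerre.measurable_voidInd.comp (measurable_toMeasure_section hA.measurableSet))
      hS.measurableSet).comp hη.measurable
  have hle : ∀ ω, Set.indicator {1} 1 ((η ω).toMeasure S) ≤
      ∫⁻ p in S, voidInd ((η ω).toMeasure (S \ {p})) ∂(η ω).toMeasure := by
    intro ω
    by_cases h : (η ω).toMeasure S = 1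
    · have hae : ∀ᵐ p ∂(η ω).toMeasure.restrict S,
          voidInd ((η ω).toMeasure (S \ {p})) = 1 := by
        filter_upwards [ae_restrict_mem hS.measurableSet, ae_restrict_of_ae (η ω).ae_mem_points]
          with p hpS hp
        have h1 := (η ω).one_le_of_ne_zero (measurableSet_singleton p) hp
        rw [measure_sdiff (Set.singleton_subset_iff.mpr hpS)
          (measurableSet_singleton p).nullMeasurableSet ((η ω).singleton_ne_top p), h,
          tsub_eq_zero_of_le h1, voidInd_zero]
      rw [lintegral_congr_ae hae]
      simp [h]
    · simp [h]
  have hae := ae_eq_of_ae_le_of_lintegral_le (Filter.Eventually.of_forall hle)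
    (by rw [hprob]; exact ENNReal.mul_ne_top ENNReal.ofReal_ne_top hΛS) hmeas.aemeasurable
    (by rw [key, hprob])
  filter_upwards [hae] with ω hω
  rw [← hω]
  exact Set.indicator_le_self' (by simp) _

/-- A Poisson process with diffuse, locally finite intensity measure is almost surely simple. -/
theorem IsPoissonProcess.ae_simple [NullSingletonClass Λ] [IsLocallyFiniteMeasure Λ]
    (hη : IsPoissonProcess P η Λ) : ∀ᵐ ω ∂P, ∀ p ∈ (η ω).points, (η ω).toMeasure {p} = 1 := by
  have hall : ∀ᵐ ω ∂P, ∀ S ∈ TopologicalSpace.countableBasis X, Λ S ≠ ∞ →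
      ∫⁻ p in S, voidInd ((η ω).toMeasure (S \ {p})) ∂(η ω).toMeasure ≤ 1 := by
    rw [ae_ball_iff (TopologicalSpace.countable_countableBasis X)]
    intro S hS
    by_cases h : Λ S = ∞
    · simp [h]
    · filter_upwards [hη.ae_lintegral_voidInd_diff_singleton
        (TopologicalSpace.isOpen_of_mem_countableBasis hS) h] with ω hω _ using hω
  filter_upwards [hall] with ω hω p hp
  refine le_antisymm ?_ ((η ω).one_le_of_ne_zero (measurableSet_singleton p) hp)
  obtain ⟨U, hU, hpU, hU0⟩ := (η ω).exists_isOpen_inter_null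
    (measurableSet_singleton p).compl (x := p) (by simp)
  obtain ⟨V, hpV, hV, hΛV⟩ := Λ.exists_isOpen_measure_lt_top p
  obtain ⟨S, hS, hpS, hSUV⟩ := (TopologicalSpace.isBasis_countableBasis X).exists_subset_of_mem_open
    (show p ∈ U ∩ V from ⟨hpU, hpV⟩) (hU.inter hV)
  have h0 : (η ω).toMeasure (S \ {p}) = 0 :=
    measure_mono_null (Set.inter_subset_inter_left _ (hSUV.trans Set.inter_subset_left)) hU0
  calc (η ω).toMeasure {p}
      = ∫⁻ q in {p}, voidInd ((η ω).toMeasure (S \ {q})) ∂(η ω).toMeasure := by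
        simp [h0]
    _ ≤ ∫⁻ q in S, voidInd ((η ω).toMeasure (S \ {q})) ∂(η ω).toMeasure :=
        lintegral_mono_set (Set.singleton_subset_iff.mpr hpS)
    _ ≤ 1 := hω S hS (ne_top_of_le_ne_top hΛV.ne
        (measure_mono (hSUV.trans Set.inter_subset_right)))

end Simple

/-! ### The Laguerre thinning -/

section Laguerre

variable {d : ℕ}

/-- The pairs `(p, q)` such that `q = (x', h')` prevents the translate `x + y` of the nucleus of
`p = (x, h)` from lying in the Laguerre cell of `p`. -/
def blockingRel (y : EuclideanSpace ℝ (Fin d)) : Set (WPoint d × WPoint d) :=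
  {w | ‖w.1.1 + y - w.2.1‖ ^ 2 + (w.2.2 : ℝ) < ‖y‖ ^ 2 + (w.1.2 : ℝ)}

lemma isOpen_blockingRel (y : EuclideanSpace ℝ (Fin d)) : IsOpen (blockingRel y) :=
  isOpen_lt (by fun_prop) (by fun_prop)

lemma notMem_blockingRel_self (y : EuclideanSpace ℝ (Fin d)) (p : WPoint d) :
    (p, p) ∉ blockingRel y := by
  simp [blockingRel]

lemma mem_thinningPoints_iff (y : EuclideanSpace ℝ (Fin d)) (μ : CountingMeasure (WPoint d))
    {p : WPoint d} (hp : p ∈ μ.points) :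
    p ∈ thinningPoints y μ ↔ μ.toMeasure (Prod.mk p ⁻¹' blockingRel y) = 0 := by
  rw [μ.measure_eq_zero_iff]
  simp [thinningPoints, hp, laguerreCell, blockingRel]

lemma thinning_apply (y : EuclideanSpace ℝ (Fin d)) (μ : CountingMeasure (WPoint d))
    {B : Set (WPoint d)} (hB : MeasurableSet B) :
    (thinning y μ).toMeasure B =
      ∫⁻ p in B, voidInd (μ.toMeasure (Prod.mk p ⁻¹' blockingRel y)) * (μ.toMeasure {p})⁻¹
        ∂μ.toMeasure :=
  μ.ofSubset_apply _ (fun _ hp => mem_thinningPoints_iff y μ hp) hB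

lemma measurable_thinning (y : EuclideanSpace ℝ (Fin d)) :
    Measurable (thinning y : CountingMeasure (WPoint d) → CountingMeasure (WPoint d)) := by
  refine Measurable.subtype_mk (Measure.measurable_of_measurable_coe _ fun B hB => ?_)
  change Measurable fun μ => (thinning y μ).toMeasure B
  simp_rw [fun μ => thinning_apply y μ hB]
  refine measurable_setLIntegral_toMeasure
    (f := fun z => voidInd (z.1.toMeasure (Prod.mk z.2 ⁻¹' blockingRel y)) *
      (z.1.toMeasure {z.2})⁻¹) (Measurable.mul ?_ (Measurable.inv ?_)) hB
  · exact measurable_voidInd.comp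
      (measurable_toMeasure_section (isOpen_blockingRel y).measurableSet)
  · have h : ∀ p : WPoint d, Prod.mk p ⁻¹' Set.diagonal (WPoint d) = {p} := fun p => by
      ext q; simp [eq_comm]
    simpa only [h] using measurable_toMeasure_section (measurableSet_diagonal (α := WPoint d))

lemma volume_blocking_section (hd : d ≠ 0) (c : EuclideanSpace ℝ (Fin d)) (r : ℝ) :
    volume {x' : EuclideanSpace ℝ (Fin d) | ‖c - x'‖ ^ 2 < r} =
      ENNReal.ofReal (kappa d * max r 0 ^ ((d : ℝ) / 2)) := by
  have hne : Nonempty (Fin d) := Fin.pos_iff_nonempty.mp (Nat.pos_of_ne_zero hd)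
  rcases le_or_gt r 0 with hr | hr
  · have h0 : (d : ℝ) / 2 ≠ 0 := by positivity
    have : {x' : EuclideanSpace ℝ (Fin d) | ‖c - x'‖ ^ 2 < r} = ∅ :=
      Set.eq_empty_of_forall_notMem fun x' hx' =>
        absurd (lt_of_le_of_lt (sq_nonneg _) hx') (not_lt.mpr hr)
    rw [this, max_eq_right hr, Real.zero_rpow h0]
    simp
  · have : {x' : EuclideanSpace ℝ (Fin d) | ‖c - x'‖ ^ 2 < r} = Metric.ball c (Real.sqrt r) := by
      ext x'
      rw [Set.mem_ofPred_eq, Metric.mem_ball', dist_eq_norm, Real.lt_sqrt (norm_nonneg _)]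
    have hpow : Real.sqrt r ^ d = r ^ ((d : ℝ) / 2) := by
      rw [Real.sqrt_eq_rpow, ← Real.rpow_natCast, ← Real.rpow_mul hr.le]
      congr 1
      ring
    rw [this, Measure.addHaar_ball _ _ (Real.sqrt_nonneg r), finrank_euclideanSpace_fin,
      max_eq_left hr.le, hpow, mul_comm (kappa d), ENNReal.ofReal_mul (by positivity), kappa,
      ENNReal.ofReal_toReal measure_closedBall_lt_top.ne, Measure.addHaar_closedBall_eq_addHaar_ball]

variable {𝔽 : Measure (Set.Ioi (0 : ℝ))}

lemma IsBoundedlyFinite.measure_le_lt_top (h𝔽 : IsBoundedlyFinite 𝔽) (s : ℝ) :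
    𝔽 {t : Set.Ioi (0 : ℝ) | (t : ℝ) ≤ s} < ∞ := by
  refine h𝔽 _ (measurableSet_le measurable_subtype_coe measurable_const) ?_
  refine Metric.isBounded_iff.mpr ⟨s, fun t ht t' ht' => ?_⟩
  have h1 : (0 : ℝ) < t := t.2
  have h2 : (0 : ℝ) < t' := t'.2
  rw [Set.mem_ofPred_eq] at ht ht'
  rw [Subtype.dist_eq, Real.dist_eq, abs_le]
  constructor <;> linarith

lemma measure_blocking [SFinite 𝔽] (h𝔽 : IsBoundedlyFinite 𝔽) (hd : d ≠ 0)
    (y : EuclideanSpace ℝ (Fin d)) (p : WPoint d) :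
    ((volume : Measure (EuclideanSpace ℝ (Fin d))).prod 𝔽) (Prod.mk p ⁻¹' blockingRel y) =
      ENNReal.ofReal (kappa d * ∫ t in {t : Set.Ioi (0 : ℝ) | (t : ℝ) ≤ ‖y‖ ^ 2 + (p.2 : ℝ)},
        (‖y‖ ^ 2 + (p.2 : ℝ) - (t : ℝ)) ^ ((d : ℝ) / 2) ∂𝔽) := by
  set s : ℝ := ‖y‖ ^ 2 + (p.2 : ℝ) with hs
  set T : Set (Set.Ioi (0 : ℝ)) := {t | (t : ℝ) ≤ s} with hT
  have hTm : MeasurableSet T := measurableSet_le measurable_subtype_coe measurable_const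
  have h0 : (d : ℝ) / 2 ≠ 0 := by positivity
  have hsec : ∀ t : Set.Ioi (0 : ℝ),
      volume ((fun x' => (x', t)) ⁻¹' (Prod.mk p ⁻¹' blockingRel y)) =
        T.indicator (fun t => ENNReal.ofReal (kappa d * (s - (t : ℝ)) ^ ((d : ℝ) / 2))) t := by
    intro t
    have : (fun x' => (x', t)) ⁻¹' (Prod.mk p ⁻¹' blockingRel y) =
        {x' | ‖p.1 + y - x'‖ ^ 2 < s - (t : ℝ)} := by
      ext x'
      simp [blockingRel, lt_sub_iff_add_lt, hs]
    rw [this, volume_blocking_section hd]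
    by_cases ht : t ∈ T
    · rw [Set.indicator_of_mem ht, max_eq_left (sub_nonneg.mpr ht)]
    · rw [Set.indicator_of_notMem ht,
        max_eq_right (sub_nonpos.mpr (le_of_lt (not_le.mp ht))), Real.zero_rpow h0]
      simp
  have hmeas : Measurable fun t : Set.Ioi (0 : ℝ) => (s - (t : ℝ)) ^ ((d : ℝ) / 2) := by fun_prop
  have hnn : ∀ t ∈ T, 0 ≤ (s - (t : ℝ)) ^ ((d : ℝ) / 2) := fun t ht =>
    Real.rpow_nonneg (sub_nonneg.mpr ht) _
  have hint : IntegrableOn (fun t : Set.Ioi (0 : ℝ) => (s - (t : ℝ)) ^ ((d : ℝ) / 2)) T 𝔽 := by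
    refine Measure.integrableOn_of_bounded (M := s ^ ((d : ℝ) / 2))
      (h𝔽.measure_le_lt_top s).ne hmeas.aestronglyMeasurable ?_
    filter_upwards [ae_restrict_mem hTm] with t ht
    rw [Real.norm_of_nonneg (hnn t ht)]
    have ht0 : (0 : ℝ) < t := t.2
    exact Real.rpow_le_rpow (sub_nonneg.mpr ht) (by linarith) (by positivity)
  rw [Measure.prod_apply_symm ((isOpen_blockingRel y).measurableSet.preimage
    measurable_prodMk_left), lintegral_congr hsec, lintegral_indicator hTm,
    ← integral_const_mul, ofReal_integral_eq_lintegral_ofReal (hint.const_mul _)]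
  filter_upwards [ae_restrict_mem hTm] with t ht
  exact mul_nonneg ENNReal.toReal_nonneg (hnn t ht)

end Laguerre

/-! ### The intensity of the thinning -/

section Intensity

variable {d : ℕ} {Ω : Type*} [MeasurableSpace Ω] {P : Measure Ω} [IsProbabilityMeasure P]
  {η : Ω → CountingMeasure (WPoint d)}

/-- A Mecke-type formula for the thinning, on sets of finite intensity. -/
lemma IsPoissonProcess.intensityMeasure_thinning {Λ : Measure (WPoint d)} [NullSingletonClass Λ]
    [IsLocallyFiniteMeasure Λ] (hη : IsPoissonProcess P η Λ) (y : EuclideanSpace ℝ (Fin d))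
    (hΛ : ∀ p, Λ (Prod.mk p ⁻¹' blockingRel y) ≠ ∞) {S : Set (WPoint d)} (hS : MeasurableSet S)
    (hΛS : Λ S ≠ ∞) :
    intensityMeasure P (fun ω => thinning y (η ω)) S =
      ∫⁻ p in S, ENNReal.ofReal (Real.exp (-(Λ (Prod.mk p ⁻¹' blockingRel y)).toReal)) ∂Λ := by
  have hA := isOpen_blockingRel y
  rw [intensityMeasure_apply (ξ := fun ω => thinning y (η ω))
    ((measurable_thinning y).comp hη.measurable) hS]
  have h1 : ∀ᵐ ω ∂P, (thinning y (η ω)).toMeasure S =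
      ∫⁻ p in S, voidInd ((η ω).toMeasure (Prod.mk p ⁻¹' blockingRel y)) ∂(η ω).toMeasure := by
    filter_upwards [hη.ae_simple] with ω hω
    rw [thinning_apply y _ hS]
    refine lintegral_congr_ae ?_
    filter_upwards [ae_restrict_of_ae (η ω).ae_mem_points] with p hp
    rw [hω p hp, inv_one, mul_one]
  rw [lintegral_congr_ae h1, hη.lintegral_voidInd_open hA (notMem_blockingRel_self y) hS hΛS]
  exact lintegral_congr fun p => hη.lintegral_voidInd
    (hA.measurableSet.preimage measurable_prodMk_left) (hΛ p)

end Intensity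

end PoissonLaguerre

theorem mainTheorem7 {d : ℕ} (hd : 2 ≤ d)
    {Ω : Type*} [MeasurableSpace Ω] (P : Measure Ω) [IsProbabilityMeasure P]
    (𝔽 : Measure (Set.Ioi (0 : ℝ))) (h𝔽 : PoissonLaguerre.IsBoundedlyFinite 𝔽)
    (η : Ω → PoissonLaguerre.CountingMeasure (PoissonLaguerre.WPoint d))
    (hη : PoissonLaguerre.IsPoissonProcess P η
      ((volume : Measure (EuclideanSpace ℝ (Fin d))).prod 𝔽))
    (y : EuclideanSpace ℝ (Fin d)) :
    Measurable (fun ω => PoissonLaguerre.thinning y (η ω)) ∧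
    ∀ (B : Set (EuclideanSpace ℝ (Fin d))), MeasurableSet B → ∀ z : ℝ, 0 ≤ z →
      PoissonLaguerre.intensityMeasure P (fun ω => PoissonLaguerre.thinning y (η ω))
          (B ×ˢ {h : Set.Ioi (0 : ℝ) | (h : ℝ) ≤ z})
        = volume B * ∫⁻ h in {h : Set.Ioi (0 : ℝ) | (h : ℝ) ≤ z},
            ENNReal.ofReal (Real.exp (-(PoissonLaguerre.kappa d *
              ∫ t in {t : Set.Ioi (0 : ℝ) | (t : ℝ) ≤ ‖y‖ ^ 2 + (h : ℝ)},
                (‖y‖ ^ 2 + (h : ℝ) - (t : ℝ)) ^ ((d : ℝ) / 2) ∂𝔽))) ∂𝔽 := by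
  refine ⟨(PoissonLaguerre.measurable_thinning y).comp hη.measurable, fun B hB z _ => ?_⟩
  have hd0 : d ≠ 0 := by omega
  have : Nonempty (Fin d) := ⟨⟨0, by omega⟩⟩
  have : IsLocallyFiniteMeasure 𝔽 := ⟨fun t => ⟨Metric.ball t 1, Metric.ball_mem_nhds t one_pos,
    h𝔽 _ measurableSet_ball Metric.isBounded_ball⟩⟩
  have hblock := PoissonLaguerre.measure_blocking h𝔽 hd0 y
  set T : Set (Set.Ioi (0 : ℝ)) := {h | (h : ℝ) ≤ z} with hT
  have hTm : MeasurableSet T := measurableSet_le measurable_subtype_coe measurable_const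
  have hTfin : 𝔽 T < ∞ := h𝔽.measure_le_lt_top z
  have hnn : ∀ h : Set.Ioi (0 : ℝ), 0 ≤ PoissonLaguerre.kappa d *
      ∫ t in {t : Set.Ioi (0 : ℝ) | (t : ℝ) ≤ ‖y‖ ^ 2 + (h : ℝ)},
        (‖y‖ ^ 2 + (h : ℝ) - (t : ℝ)) ^ ((d : ℝ) / 2) ∂𝔽 := fun h =>
    mul_nonneg ENNReal.toReal_nonneg (setIntegral_nonneg
      (measurableSet_le measurable_subtype_coe measurable_const)
      fun t ht => Real.rpow_nonneg (sub_nonneg.mpr ht) _)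
  -- The case of sets `C` of finite volume.
  have hfin : ∀ C : Set (EuclideanSpace ℝ (Fin d)), MeasurableSet C → volume C ≠ ∞ →
      PoissonLaguerre.intensityMeasure P (fun ω => PoissonLaguerre.thinning y (η ω)) (C ×ˢ T)
        = volume C * ∫⁻ h in T, ENNReal.ofReal (Real.exp (-(PoissonLaguerre.kappa d *
              ∫ t in {t : Set.Ioi (0 : ℝ) | (t : ℝ) ≤ ‖y‖ ^ 2 + (h : ℝ)},
                (‖y‖ ^ 2 + (h : ℝ) - (t : ℝ)) ^ ((d : ℝ) / 2) ∂𝔽))) ∂𝔽 := by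
    intro C hC hCfin
    have hmeas : Measurable fun p : PoissonLaguerre.WPoint d => ENNReal.ofReal (Real.exp
        (-(((volume : Measure (EuclideanSpace ℝ (Fin d))).prod 𝔽)
          (Prod.mk p ⁻¹' PoissonLaguerre.blockingRel y)).toReal)) :=
      (Real.measurable_exp.comp (measurable_measure_prodMk_left
        (PoissonLaguerre.isOpen_blockingRel y).measurableSet).ennreal_toReal.neg).ennreal_ofReal
    rw [hη.intensityMeasure_thinning y (fun p => by rw [hblock]; exact ENNReal.ofReal_ne_top)
      (hC.prod hTm) (by rw [Measure.prod_prod]; exact ENNReal.mul_ne_top hCfin hTfin.ne),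
      setLIntegral_prod _ hmeas.aemeasurable]
    simp_rw [hblock, ENNReal.toReal_ofReal (hnn _)]
    rw [setLIntegral_const, mul_comm]
  have hU : B ×ˢ T = ⋃ n : ℕ, (B ∩ Metric.ball 0 n) ×ˢ T := by
    rw [← Set.iUnion_prod_const, ← Set.inter_iUnion, Metric.iUnion_ball_nat, Set.inter_univ]
  have hmono : Monotone fun n : ℕ => B ∩ Metric.ball (0 : EuclideanSpace ℝ (Fin d)) n :=
    fun m n hmn => Set.inter_subset_inter_right _ (Metric.ball_subset_ball (by exact_mod_cast hmn))
  have hvol : volume B = ⨆ n : ℕ, volume (B ∩ Metric.ball 0 n) := by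
    rw [← hmono.measure_iUnion, ← Set.inter_iUnion, Metric.iUnion_ball_nat, Set.inter_univ]
  rw [hU, Monotone.measure_iUnion fun m n hmn => Set.prod_mono_left (hmono hmn), hvol,
    ENNReal.iSup_mul]
  exact iSup_congr fun n => hfin _ (hB.inter measurableSet_ball)
    (ne_top_of_le_ne_top measure_ball_lt_top.ne (measure_mono Set.inter_subset_right))
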